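/- All algebras are associative and unital. For a real Banach algebra $B$ let $B_{\mathbb C}=B\oplus iB$ be its complexification, with the topology of $B\times B$. An element $b\in B$ has polynomial growth if for every continuous submultiplicative seminorm $\|\cdot\|$ on the complex algebra $B_{\mathbb C}$ there are $K>0$ and $\alpha\ge 0$ such that $\|e^{isb}\|\le K(1+|s|)^{\alpha}$ for all $s\in\mathbb R$. The algebra $B$ is of polynomial growth if all its elements have polynomial growth. Theorem. Let $A$ and $\mathfrak A$ be real Banach algebras and let $\pi\colon\mathfrak A\to A$ be a surjective continuous homomorphism, so that $0\leftarrow A\leftarrow\mathfrak A\leftarrow I\leftarrow 0$, with $I=\ker\pi$, is an extension of $A$ by the closed ideal $I$. Suppose that the extension is nilpotent (there is $n\in\mathbb N$ such that $r_1\cdots r_n=0$ for all $r_1,\dots,r_n\in I$) and split (there is a continuous homomorphism $\rho\colon A\to\mathfrak A$ with $\pi\circ\rho=\mathrm{id}_A$). If $A$ is of polynomial growth, then $\mathfrak A$ is of polynomial growth. -/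

import Mathlib

/-- The complexification `A ⊕ iA` of a real algebra `A`: the element `⟨a, b⟩` stands for
`a + i b`. -/
@[ext]
structure Complexification (A : Type*) where
  /-- the real part -/
  re : A
  /-- the imaginary part -/
  im : A

namespace Complexification

variable {A : Type*}

section Ring

variable [Ring A]

instance : Zero (Complexification A) := ⟨⟨0, 0⟩⟩
instance : One (Complexification A) := ⟨⟨1, 0⟩⟩
instance : Add (Complexification A) := ⟨fun x y => ⟨x.re + y.re, x.im + y.im⟩⟩
instance : Neg (Complexification A) := ⟨fun x => ⟨-x.re, -x.im⟩⟩
instance : Mul (Complexification A) :=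
  ⟨fun x y => ⟨x.re * y.re - x.im * y.im, x.re * y.im + x.im * y.re⟩⟩

@[simp] theorem zero_re : (0 : Complexification A).re = 0 := rfl
@[simp] theorem zero_im : (0 : Complexification A).im = 0 := rfl
@[simp] theorem one_re : (1 : Complexification A).re = 1 := rfl
@[simp] theorem one_im : (1 : Complexification A).im = 0 := rfl
@[simp] theorem add_re (x y : Complexification A) : (x + y).re = x.re + y.re := rfl
@[simp] theorem add_im (x y : Complexification A) : (x + y).im = x.im + y.im := rfl
@[simp] theorem neg_re (x : Complexification A) : (-x).re = -x.re := rfl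
@[simp] theorem neg_im (x : Complexification A) : (-x).im = -x.im := rfl
@[simp] theorem mul_re (x y : Complexification A) :
    (x * y).re = x.re * y.re - x.im * y.im := rfl
@[simp] theorem mul_im (x y : Complexification A) :
    (x * y).im = x.re * y.im + x.im * y.re := rfl

instance : Ring (Complexification A) where
  add_assoc x y z := by ext <;> simp [add_assoc]
  zero_add x := by ext <;> simp
  add_zero x := by ext <;> simp
  add_comm x y := by ext <;> simp [add_comm]
  neg_add_cancel x := by ext <;> simp
  mul_assoc x y z := by ext <;> simp <;> noncomm_ring
  one_mul x := by ext <;> simp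
  mul_one x := by ext <;> simp
  zero_mul x := by ext <;> simp
  mul_zero x := by ext <;> simp
  left_distrib x y z := by ext <;> simp <;> noncomm_ring
  right_distrib x y z := by ext <;> simp <;> noncomm_ring
  nsmul := nsmulRec
  zsmul := zsmulRec

variable [Algebra ℝ A]

/-- Complex scalars act by `(s + i t) • (a + i b) = (s a - t b) + i (s b + t a)`. -/
instance : SMul ℂ (Complexification A) :=
  ⟨fun z x => ⟨z.re • x.re - z.im • x.im, z.re • x.im + z.im • x.re⟩⟩

@[simp] theorem smul_re (z : ℂ) (x : Complexification A) :
    (z • x).re = z.re • x.re - z.im • x.im := rfl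
@[simp] theorem smul_im (z : ℂ) (x : Complexification A) :
    (z • x).im = z.re • x.im + z.im • x.re := rfl

instance : Module ℂ (Complexification A) where
  one_smul x := by ext <;> simp
  mul_smul z w x := by ext <;> simp <;> module
  smul_zero z := by ext <;> simp
  smul_add z x y := by ext <;> simp <;> module
  add_smul z w x := by ext <;> simp <;> module
  zero_smul x := by ext <;> simp

instance : Algebra ℂ (Complexification A) :=
  Algebra.ofModule
    (fun z x y => by
      ext <;> simp [sub_mul, add_mul, smul_sub, smul_add] <;> abel)
    (fun z x y => by
      ext <;> simp [mul_sub, mul_add, smul_sub, smul_add] <;> abel)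

/-- The canonical embedding `a ↦ a + i 0` of a real algebra into its complexification. -/
def ofReal (a : A) : Complexification A := ⟨a, 0⟩

end Ring

section Topology

variable [TopologicalSpace A]

/-- The topology of the complexification is the product topology of `A × A`. When `A` is a
Banach algebra, it is the topology of any Banach algebra norm on the complexification that
induces the topology of `A`. -/
instance : TopologicalSpace (Complexification A) :=
  TopologicalSpace.induced (fun x => (x.re, x.im)) inferInstance

theorem continuous_re : Continuous (re : Complexification A → A) :=
  continuous_fst.comp
    (continuous_induced_dom (f := fun x : Complexification A => (x.re, x.im)))

theorem continuous_im : Continuous (im : Complexification A → A) :=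
  continuous_snd.comp
    (continuous_induced_dom (f := fun x : Complexification A => (x.re, x.im)))

theorem continuous_mk {X : Type*} [TopologicalSpace X] {f g : X → A}
    (hf : Continuous f) (hg : Continuous g) :
    Continuous fun x => (⟨f x, g x⟩ : Complexification A) :=
  continuous_induced_rng.2 (hf.prodMk hg)

instance [Ring A] [IsTopologicalRing A] : IsTopologicalRing (Complexification A) where
  continuous_add := continuous_mk
    ((continuous_re.comp continuous_fst).add (continuous_re.comp continuous_snd))
    ((continuous_im.comp continuous_fst).add (continuous_im.comp continuous_snd))
  continuous_mul := continuous_mk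
    (((continuous_re.comp continuous_fst).mul (continuous_re.comp continuous_snd)).sub
      ((continuous_im.comp continuous_fst).mul (continuous_im.comp continuous_snd)))
    (((continuous_re.comp continuous_fst).mul (continuous_im.comp continuous_snd)).add
      ((continuous_im.comp continuous_fst).mul (continuous_re.comp continuous_snd)))
  continuous_neg := continuous_mk continuous_re.neg continuous_im.neg

end Topology

end Complexification

/-- An element `b` of a complex Arens-Michael algebra (in particular, of the complexification of
a real Banach algebra) has polynomial growth if for every continuous submultiplicative seminorm
`q` there are `K > 0` and `α ≥ 0` with `q (exp (i s b)) ≤ K (1 + |s|) ^ α` for all real `s`. -/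
def HasPolynomialGrowth {B : Type*} [Ring B] [Algebra ℂ B] [TopologicalSpace B]
    [IsTopologicalRing B] (b : B) : Prop :=
  ∀ q : Seminorm ℂ B, Continuous q → (∀ x y : B, q (x * y) ≤ q x * q y) →
    ∃ K : ℝ, 0 < K ∧ ∃ α : ℝ, 0 ≤ α ∧
      ∀ s : ℝ, q (NormedSpace.exp ((Complex.I * (s : ℂ)) • b)) ≤ K * (1 + |s|) ^ α

/-- A real Banach algebra is of polynomial growth if each of its elements has polynomial growth
in the complexification. -/
def IsPolynomialGrowthAlgebra (A : Type*) [NormedRing A] [NormedAlgebra ℝ A] : Prop :=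
  ∀ a : A, HasPolynomialGrowth (Complexification.ofReal a)

/-- A continuous homomorphism `π : E → A` of real Banach algebras presents `E` as an extension of
`A` by the closed ideal `ker π` when it is surjective:
`0 ← A ← E ← ker π ← 0` is then exact. -/
def IsBanachExtension {E A : Type*} [NormedRing E] [NormedAlgebra ℝ E] [NormedRing A]
    [NormedAlgebra ℝ A] (π : E →A[ℝ] A) : Prop :=
  Function.Surjective π

/-- The extension is nilpotent: there is `n` such that all products of `n` elements of the
ideal `ker π` vanish. -/
def IsNilpotentExtension {E A : Type*} [NormedRing E] [NormedAlgebra ℝ E] [NormedRing A]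
    [NormedAlgebra ℝ A] (π : E →A[ℝ] A) : Prop :=
  ∃ n : ℕ, ∀ r : Fin n → E, (∀ j, π (r j) = 0) → (List.ofFn r).prod = 0

/-- The extension splits: `π` has a right inverse that is a continuous homomorphism. -/
def IsSplitExtension {E A : Type*} [NormedRing E] [NormedAlgebra ℝ E] [NormedRing A]
    [NormedAlgebra ℝ A] (π : E →A[ℝ] A) : Prop :=
  ∃ ρ : A →A[ℝ] E, ∀ a : A, π (ρ a) = a

/-! Modulo the ideal, `b` agrees with `ρ (π b)`. Put `u = exp (i b)` and `v = exp (i ρ (π b))` in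
the complexification of `E`. Powers of `v` grow polynomially, because `q ∘ ρ` is an admissible
seminorm on the complexification of `A`; and `u - v` lies in the kernel of the complexified `π`,
which is again nilpotent. The telescoping identity `pow_eq_pow_add_sum`, a discrete Duhamel formula,
writes `u ^ n` as `v ^ n` plus `n` terms `v ^ k * (u - v) * u ^ j`. Substituting it again for `u ^
j` adds a factor from the kernel each time, so the process stops by nilpotency, and each round costs
only a polynomial factor in `n` (`exists_seminorm_mul_pow_le`). Real exponents reduce to integer
ones by compactness of `[0, 1]`, and negative ones to positive ones by replacing `b` with `-b`. -/

open NormedSpace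

namespace Complexification

/-! ### Normed structure and exponential on the complexification -/

section Norm

variable (A : Type*) [NormedRing A]

/-- The `ℓ¹` norm turns the complexification of a normed ring into a normed ring whose topology is
the given one. -/
noncomputable abbrev normedRing : NormedRing (Complexification A) :=
  { (inferInstance : Ring (Complexification A)),
    -- Replacing the topology makes it definitionally the given one, so `exp` and the continuity of
    -- `q` need no transport.
    (MetricSpace.induced (fun x : Complexification A => WithLp.toLp 1 (x.re, x.im))
      (fun x y h => by
        have h' := congrArg WithLp.ofLp h
        exact Complexification.ext (congrArg Prod.fst h') (congrArg Prod.snd h'))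
      inferInstance).replaceTopology (by
        change TopologicalSpace.induced _ _ = TopologicalSpace.induced _ (TopologicalSpace.induced _ _)
        rw [induced_compose]
        rfl) with
    norm := fun x => ‖x.re‖ + ‖x.im‖
    dist_eq := fun x y => by
      change dist (WithLp.toLp 1 (x.re, x.im)) (WithLp.toLp 1 (y.re, y.im)) = _
      rw [WithLp.prod_dist_eq_of_L1, dist_eq_norm_neg_add, dist_eq_norm_neg_add]
      rfl
    norm_mul_le := fun x y => by
      change ‖x.re * y.re - x.im * y.im‖ + ‖x.re * y.im + x.im * y.re‖ ≤
        (‖x.re‖ + ‖x.im‖) * (‖y.re‖ + ‖y.im‖)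
      have h₁ := norm_sub_le (x.re * y.re) (x.im * y.im)
      have h₂ := norm_add_le (x.re * y.im) (x.im * y.re)
      linarith [norm_mul_le x.re y.re, norm_mul_le x.im y.im, norm_mul_le x.re y.im,
        norm_mul_le x.im y.re] }

attribute [local instance] normedRing

theorem norm_def (x : Complexification A) : ‖x‖ = ‖x.re‖ + ‖x.im‖ := rfl

instance completeSpace [CompleteSpace A] : CompleteSpace (Complexification A) := by
  have h : IsUniformInducing (fun x : Complexification A => WithLp.toLp 1 (x.re, x.im)) := ⟨rfl⟩
  rw [h.completeSpace_congr fun y => ⟨⟨y.ofLp.1, y.ofLp.2⟩, rfl⟩]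
  infer_instance

variable [NormedAlgebra ℝ A]

theorem real_smul_eq (r : ℝ) (x : Complexification A) : r • x = ⟨r • x.re, r • x.im⟩ := by
  change ((r : ℂ) • x : Complexification A) = _
  apply Complexification.ext
  · rw [smul_re, Complex.ofReal_re, Complex.ofReal_im, zero_smul, sub_zero]
  · rw [smul_im, Complex.ofReal_re, Complex.ofReal_im, zero_smul, add_zero]

/-- The complexification of a real normed algebra as a real normed algebra. -/
noncomputable abbrev normedAlgebraReal : NormedAlgebra ℝ (Complexification A) :=
  { (inferInstance : Algebra ℝ (Complexification A)) with
    norm_smul_le := fun r x => by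
      rw [real_smul_eq, norm_def, norm_def, norm_smul, norm_smul, mul_add] }

attribute [local instance] normedAlgebraReal

/-- The complexification of a real normed algebra as a rational normed algebra. -/
noncomputable abbrev normedAlgebraRat : NormedAlgebra ℚ (Complexification A) :=
  NormedAlgebra.restrictScalars ℚ ℝ (Complexification A)

attribute [local instance] normedAlgebraRat

variable {A}

theorem exp_add_of_commute [CompleteSpace A] {x y : Complexification A} (h : Commute x y) :
    exp (x + y) = exp x * exp y :=
  NormedSpace.exp_add_of_commute h

theorem exp_nsmul [CompleteSpace A] (n : ℕ) (x : Complexification A) :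
    exp (n • x) = exp x ^ n :=
  NormedSpace.exp_nsmul n x

theorem continuous_exp_I_mul_smul [CompleteSpace A] (x : Complexification A) :
    Continuous fun s : ℝ => exp ((Complex.I * (s : ℂ)) • x) := by
  have h : (fun s : ℝ => exp ((Complex.I * (s : ℂ)) • x)) =
      fun s : ℝ => exp (s • (Complex.I • x)) := by
    funext s
    congr 1
    change _ = (s : ℂ) • (Complex.I • x)
    rw [smul_smul, mul_comm]
  rw [h]
  exact NormedSpace.exp_continuous.comp (continuous_id.smul continuous_const)

end Norm

/-! ### Functoriality of the complexification -/

section Map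

variable {A B : Type*} [NormedRing A] [NormedAlgebra ℝ A] [NormedRing B] [NormedAlgebra ℝ B]

/-- The complexification of a continuous homomorphism of real algebras. -/
def map (f : A →A[ℝ] B) : Complexification A →ₐ[ℂ] Complexification B :=
  AlgHom.ofLinearMap
    { toFun := fun x => ⟨f x.re, f x.im⟩
      map_add' := fun x y => by ext <;> simp
      map_smul' := fun z x => by ext <;> simp }
    (by ext <;> simp) (fun x y => by ext <;> simp)

@[simp] theorem map_re (f : A →A[ℝ] B) (x : Complexification A) : (map f x).re = f x.re := rfl

@[simp] theorem map_im (f : A →A[ℝ] B) (x : Complexification A) : (map f x).im = f x.im := rfl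

@[simp] theorem map_ofReal (f : A →A[ℝ] B) (a : A) : map f (ofReal a) = ofReal (f a) := by
  ext <;> simp [ofReal]

theorem continuous_map (f : A →A[ℝ] B) : Continuous (map f) :=
  continuous_mk (f.continuous.comp continuous_re) (f.continuous.comp continuous_im)

attribute [local instance] normedRing normedAlgebraRat in
theorem map_exp [CompleteSpace A] (f : A →A[ℝ] B) (x : Complexification A) :
    map f (exp x) = exp (map f x) :=
  NormedSpace.map_exp (map f) (continuous_map f) x

end Map

end Complexification

/-! ### Nilpotency and growth of powers -/

section AnnihilatorChain

variable {B : Type*} [Ring B]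

/-- The elements `x` such that `x * r₁ * ⋯ * rₘ = 0` for all `r₁, …, rₘ ∈ I`. -/
def rightAnnihilated (I : Set B) : ℕ → Set B
  | 0 => {0}
  | m + 1 => {x | ∀ r ∈ I, x * r ∈ rightAnnihilated I m}

theorem rightAnnihilated_add {I : Set B} {m : ℕ} {x y : B} (hx : x ∈ rightAnnihilated I m)
    (hy : y ∈ rightAnnihilated I m) : x + y ∈ rightAnnihilated I m := by
  induction m generalizing x y with
  | zero => simp_all [rightAnnihilated]
  | succ m ih => exact fun r hr => add_mul x y r ▸ ih (hx r hr) (hy r hr)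

theorem rightAnnihilated_neg {I : Set B} {m : ℕ} {x : B} (hx : x ∈ rightAnnihilated I m) :
    -x ∈ rightAnnihilated I m := by
  induction m generalizing x with
  | zero => simp_all [rightAnnihilated]
  | succ m ih => exact fun r hr => neg_mul x r ▸ ih (hx r hr)

theorem mem_rightAnnihilated_of_prod {I : Set B} {m : ℕ} {x : B}
    (h : ∀ r : Fin m → B, (∀ j, r j ∈ I) → x * (List.ofFn r).prod = 0) :
    x ∈ rightAnnihilated I m := by
  induction m generalizing x with
  | zero => simpa [rightAnnihilated] using h Fin.elim0 (fun j => j.elim0)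
  | succ m ih =>
    intro r hr
    refine ih fun t ht => ?_
    have := h (Fin.cons r t) (Fin.cases hr ht)
    simpa [List.ofFn_succ, mul_assoc] using this

/-- Nilpotency passes to the complexification: the parts of a product are signed sums of products of
parts, and each level of the chain is closed under sums and negation. -/
theorem Complexification.mem_rightAnnihilated {I : Set B} {J : Set (Complexification B)}
    (hJ : ∀ r ∈ J, r.re ∈ I ∧ r.im ∈ I) {m : ℕ} {x : Complexification B}
    (hre : x.re ∈ rightAnnihilated I m) (him : x.im ∈ rightAnnihilated I m) :
    x ∈ rightAnnihilated J m := by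
  induction m generalizing x with
  | zero => exact Complexification.ext hre him
  | succ m ih =>
    intro r hr
    obtain ⟨h₁, h₂⟩ := hJ r hr
    refine ih ?_ (rightAnnihilated_add (hre _ h₂) (him _ h₁))
    rw [Complexification.mul_re, sub_eq_add_neg]
    exact rightAnnihilated_add (hre _ h₁) (rightAnnihilated_neg (him _ h₂))

/-- Telescoping, valid without commutativity of `u` and `v`. -/
theorem pow_eq_pow_add_sum (u v : B) (n : ℕ) :
    u ^ n = v ^ n + ∑ j ∈ Finset.range n, v ^ (n - 1 - j) * (u - v) * u ^ j := by
  induction n with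
  | zero => simp
  | succ n ih =>
    have h : ∑ j ∈ Finset.range n, v ^ (n - j) * (u - v) * u ^ j =
        v * ∑ j ∈ Finset.range n, v ^ (n - 1 - j) * (u - v) * u ^ j := by
      rw [Finset.mul_sum]
      refine Finset.sum_congr rfl fun j hj => ?_
      rw [show n - j = n - 1 - j + 1 by have := Finset.mem_range.1 hj; omega, pow_succ']
      simp only [mul_assoc]
    rw [Finset.sum_range_succ, Nat.add_sub_cancel, h, Nat.sub_self, pow_zero, one_mul,
      ← sub_eq_of_eq_add' ih, pow_succ', pow_succ']
    noncomm_ring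

/-- If `u` and `v` agree modulo a left ideal `I` and the powers of `v` grow polynomially, then so do
those of `u` on the elements annihilated by products of elements of `I`. -/
theorem exists_seminorm_mul_pow_le [Algebra ℂ B] (q : Seminorm ℂ B)
    (hq : ∀ x y : B, q (x * y) ≤ q x * q y) (I : Ideal B) {u v : B} (huv : u - v ∈ I)
    {K : ℝ} (hK : 0 ≤ K) {e : ℕ} (hv : ∀ n : ℕ, q (v ^ n) ≤ K * (1 + n) ^ e) (m : ℕ) :
    ∃ C : ℝ, 0 ≤ C ∧ ∃ d : ℕ, ∀ x ∈ rightAnnihilated (I : Set B) m, ∀ n : ℕ,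
      q (x * u ^ n) ≤ q x * (C * (1 + n) ^ d) := by
  induction m with
  | zero =>
    refine ⟨0, le_rfl, 0, fun x hx n => ?_⟩
    obtain rfl : x = 0 := hx
    simp
  | succ m ih =>
    obtain ⟨C, hC, d, h⟩ := ih
    have hw := apply_nonneg q (u - v)
    -- The first `K` pays for `x * v ^ n`, the other summand for the telescoping terms; the extra
    -- `1` in the exponent absorbs their number `n`.
    refine ⟨K + K * q (u - v) * C, by positivity, e + d + 1, fun x hx n => ?_⟩
    have hx0 := apply_nonneg q x
    have h1 : (1 : ℝ) ≤ 1 + n := by simp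
    have hterm : ∀ j ∈ Finset.range n, q (x * (v ^ (n - 1 - j) * (u - v) * u ^ j)) ≤
        q x * (K * (1 + n) ^ e * q (u - v)) * (C * (1 + n) ^ d) := by
      intro j hj
      have hjn := Finset.mem_range.1 hj
      have hj' : (j : ℝ) ≤ n := by exact_mod_cast hjn.le
      have hk' : ((n - 1 - j : ℕ) : ℝ) ≤ n := by exact_mod_cast (by omega : n - 1 - j ≤ n)
      rw [← mul_assoc]
      -- Since `I` is a left ideal, `v ^ (n - 1 - j) * (u - v)` is a single element of it, so
      -- multiplying `x` by it descends one level of the chain.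
      refine (h _ (hx _ (I.mul_mem_left _ huv)) j).trans ?_
      refine mul_le_mul ?_ (by gcongr) (by positivity) (by positivity)
      refine (hq _ _).trans (mul_le_mul_of_nonneg_left ?_ hx0)
      refine (hq _ _).trans (mul_le_mul_of_nonneg_right ((hv _).trans ?_) hw)
      gcongr
    calc q (x * u ^ n)
        = q (x * v ^ n + ∑ j ∈ Finset.range n, x * (v ^ (n - 1 - j) * (u - v) * u ^ j)) := by
          rw [pow_eq_pow_add_sum u v n, mul_add, Finset.mul_sum]
      _ ≤ q (x * v ^ n) + ∑ j ∈ Finset.range n, q (x * (v ^ (n - 1 - j) * (u - v) * u ^ j)) :=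
          (map_add_le_add q _ _).trans (add_le_add_right
            (Finset.le_sum_of_subadditive q (map_zero q).le (map_add_le_add q) _ _) _)
      _ ≤ q x * (K * (1 + n) ^ e) +
            n * (q x * (K * (1 + n) ^ e * q (u - v)) * (C * (1 + n) ^ d)) := by
          refine add_le_add ((hq _ _).trans (mul_le_mul_of_nonneg_left (hv n) hx0)) ?_
          simpa using Finset.sum_le_card_nsmul _ _ _ hterm
      _ ≤ q x * (K * (1 + n) ^ (e + d + 1)) + (1 + n) *
            (q x * (K * (1 + n) ^ e * q (u - v)) * (C * (1 + n) ^ d)) := by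
          gcongr
          · omega
          · simp
      _ = q x * ((K + K * q (u - v) * C) * (1 + n) ^ (e + d + 1)) := by ring

end AnnihilatorChain

/-! ### Growth of exponentials in the extension -/

section Extension

variable {A E : Type*} [NormedRing A] [NormedAlgebra ℝ A] [CompleteSpace A]
  [NormedRing E] [NormedAlgebra ℝ E] [CompleteSpace E]

theorem exists_exp_le_of_nonneg (π : E →A[ℝ] A) (hnil : IsNilpotentExtension π)
    (ρ : A →A[ℝ] E) (hρ : ∀ a, π (ρ a) = a) (hA : IsPolynomialGrowthAlgebra A)
    (q : Seminorm ℂ (Complexification E)) (hqc : Continuous q)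
    (hq : ∀ x y, q (x * y) ≤ q x * q y) (b : E) :
    ∃ K : ℝ, 0 ≤ K ∧ ∃ d : ℕ, ∀ s : ℝ, 0 ≤ s →
      q (exp ((Complex.I * (s : ℂ)) • Complexification.ofReal b)) ≤ K * (1 + s) ^ d := by
  obtain ⟨n₀, hn₀⟩ := hnil
  set x := Complexification.ofReal b with hx
  set a := Complexification.ofReal (π b) with ha
  have hπx : Complexification.map π x = a := Complexification.map_ofReal π b
  have hπρ : Complexification.map π (Complexification.map ρ a) = a := by
    rw [ha, Complexification.map_ofReal, Complexification.map_ofReal, hρ]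
  obtain ⟨K, hK, α, -, hKα⟩ := hA (π b) (q.comp (Complexification.map ρ).toLinearMap)
    (hqc.comp (Complexification.continuous_map ρ)) (fun y z => by
      simpa using hq (Complexification.map ρ y) (Complexification.map ρ z))
  set u := exp (Complex.I • x) with hu
  set v := exp (Complex.I • Complexification.map ρ a) with hv
  have hvn : ∀ n : ℕ, q (v ^ n) ≤ K * (1 + n) ^ ⌈α⌉₊ := by
    intro n
    have h := hKα n
    have h' : Complexification.map ρ (exp ((Complex.I * ((n : ℝ) : ℂ)) • a)) = v ^ n := by
      rw [Complexification.map_exp, hv, ← Complexification.exp_nsmul, map_smul, mul_comm,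
        mul_smul, Complex.ofReal_natCast, Nat.cast_smul_eq_nsmul]
    rw [Seminorm.comp_apply, AlgHom.toLinearMap_apply, h', Nat.abs_cast] at h
    refine h.trans (mul_le_mul_of_nonneg_left ?_ hK.le)
    rw [← Real.rpow_natCast]
    exact Real.rpow_le_rpow_of_exponent_le (by simp) (Nat.le_ceil α)
  have huv : u - v ∈ RingHom.ker (Complexification.map π) := by
    rw [RingHom.mem_ker, map_sub, Complexification.map_exp, Complexification.map_exp, map_smul,
      map_smul, hπx, hπρ, sub_self]
  obtain ⟨C, hC, d, h⟩ := exists_seminorm_mul_pow_le q hq _ huv hK.le hvn n₀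
  -- Nilpotency puts `1` at level `n₀`, so the estimate applies to `u ^ n` itself.
  have hone : (1 : Complexification E) ∈
      rightAnnihilated (RingHom.ker (Complexification.map π) : Set (Complexification E)) n₀ := by
    refine Complexification.mem_rightAnnihilated (I := {r | π r = 0}) (fun r hr => ?_)
      (mem_rightAnnihilated_of_prod fun r hr => ?_)
      (mem_rightAnnihilated_of_prod fun r hr => ?_)
    · have hr' : Complexification.map π r = 0 := hr
      exact ⟨congrArg Complexification.re hr', congrArg Complexification.im hr'⟩
    · rw [hn₀ r hr, mul_zero]
    · rw [hn₀ r hr, mul_zero]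
  -- `M` bounds the factor coming from the fractional part of `s`.
  obtain ⟨M, hM⟩ := (isCompact_Icc (a := (0 : ℝ)) (b := 1)).exists_bound_of_continuousOn
    (hqc.comp (Complexification.continuous_exp_I_mul_smul x)).continuousOn
  have hM0 : 0 ≤ M := (norm_nonneg _).trans (hM 0 (by simp))
  refine ⟨q 1 * C * M, by positivity, d, fun s hs => ?_⟩
  have hns := Nat.floor_le hs
  have hsplit : exp ((Complex.I * (s : ℂ)) • x) =
      u ^ ⌊s⌋₊ * exp ((Complex.I * ((s - ⌊s⌋₊ : ℝ) : ℂ)) • x) := by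
    rw [hu, ← Complexification.exp_nsmul, ← Complexification.exp_add_of_commute]
    · rw [← Nat.cast_smul_eq_nsmul ℂ, smul_smul, ← add_smul]
      congr 2
      push_cast
      ring
    · exact (((Commute.refl x).smul_left _).smul_left _).smul_right _
  have hfrac : q (exp ((Complex.I * ((s - ⌊s⌋₊ : ℝ) : ℂ)) • x)) ≤ M :=
    (le_abs_self _).trans (hM (s - ⌊s⌋₊) ⟨by linarith, by linarith [Nat.lt_floor_add_one s]⟩)
  have hpow : q (u ^ ⌊s⌋₊) ≤ q 1 * (C * (1 + s) ^ d) := by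
    refine le_trans (by simpa using h 1 hone ⌊s⌋₊) ?_
    gcongr
  rw [hsplit]
  calc q (u ^ ⌊s⌋₊ * exp ((Complex.I * ((s - ⌊s⌋₊ : ℝ) : ℂ)) • x))
      ≤ q (u ^ ⌊s⌋₊) * q (exp ((Complex.I * ((s - ⌊s⌋₊ : ℝ) : ℂ)) • x)) := hq _ _
    _ ≤ q 1 * (C * (1 + s) ^ d) * M :=
        mul_le_mul hpow hfrac (apply_nonneg q _) (by positivity)
    _ = q 1 * C * M * (1 + s) ^ d := by ring

end Extension

theorem mainTheorem6 {A E : Type*}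
    [NormedRing A] [NormedAlgebra ℝ A] [CompleteSpace A]
    [NormedRing E] [NormedAlgebra ℝ E] [CompleteSpace E]
    (π : E →A[ℝ] A) (hext : IsBanachExtension π) (hnil : IsNilpotentExtension π)
    (hsplit : IsSplitExtension π) (hA : IsPolynomialGrowthAlgebra A) :
    IsPolynomialGrowthAlgebra E := by
  obtain ⟨ρ, hρ⟩ := hsplit
  intro b q hqc hq
  obtain ⟨K₁, hK₁, d₁, h₁⟩ := exists_exp_le_of_nonneg π hnil ρ hρ hA q hqc hq b
  obtain ⟨K₂, hK₂, d₂, h₂⟩ := exists_exp_le_of_nonneg π hnil ρ hρ hA q hqc hq (-b)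
  -- The sums dominate both one-sided bounds; the `1` makes the constant strictly positive.
  refine ⟨K₁ + K₂ + 1, by positivity, ((d₁ + d₂ : ℕ) : ℝ), by positivity, fun s => ?_⟩
  rw [Real.rpow_natCast]
  have h1 : (1 : ℝ) ≤ 1 + |s| := by simp
  rcases le_total 0 s with hs | hs
  · refine (h₁ s hs).trans ?_
    rw [abs_of_nonneg hs] at h1 ⊢
    gcongr
    · linarith
    · omega
  · have hneg : (Complex.I * (s : ℂ)) • Complexification.ofReal b =
        (Complex.I * ((-s : ℝ) : ℂ)) • Complexification.ofReal (-b) := by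
      ext <;> simp [Complexification.ofReal]
    rw [hneg]
    refine (h₂ (-s) (by linarith)).trans ?_
    rw [abs_of_nonpos hs] at h1 ⊢
    gcongr
    · linarith
    · omega
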